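/- A small double category $\mathbb{D}$ is a category object in the category $\mathbf{Cat}$ of small categories, given by a category $\mathbb{D}_0$ of objects and vertical morphisms, a category $\mathbb{D}_1$ of horizontal morphisms and squares, and functors $s,t\colon \mathbb{D}_1\to\mathbb{D}_0$, $u\colon\mathbb{D}_0\to\mathbb{D}_1$, $m\colon\mathbb{D}_1\times_{\mathbb{D}_0}\mathbb{D}_1\to\mathbb{D}_1$ satisfying the axioms of a category; a double functor is an internal functor. Let $\mathbf{DblCat}$ be the category of small double categories and double functors, and let $N_h\colon\mathbf{DblCat}\to\mathbf{Cat}^{\Delta^{op}}$ be the horizontal nerve, $$(N_h\mathbb{D})_0=\mathbb{D}_0,\qquad (N_h\mathbb{D})_n=\underbrace{\mathbb{D}_1\times_{\mathbb{D}_0}\cdots\times_{\mathbb{D}_0}\mathbb{D}_1}_{n}\quad (n\ge 1),$$ so that the objects of $(N_h\mathbb{D})_n$ are the functors from $[n]$ to the category of objects and horizontal morphisms of $\mathbb{D}$, its morphisms are the functors from $[n]$ to the category of vertical morphisms and squares under horizontal composition, and composition is vertical. The categorical model structure on $\mathbf{Cat}$ has as weak equivalences the equivalences of categories and as fibrations the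 isofibrations, i.e. the functors $F\colon\mathbf{A}\to\mathbf{B}$ such that for every isomorphism $g\colon b\cong Fa$ in $\mathbf{B}$ there is an isomorphism $f\colon a'\cong a$ in $\mathbf{A}$ with $Fa'=b$ and $Ff=g$. In the associated Reedy model structure on $\mathbf{Cat}^{\Delta^{op}}$, a morphism $X\to Y$ is a weak equivalence if every $X_n\to Y_n$ is an equivalence of categories, and a fibration if for every $n\ge 0$ the relative matching map $$X_n\longrightarrow Y_n\times_{M_nY}M_nX$$ is an isofibration, where $M_nX=\lim_{[k]\hookrightarrow[n]}X_k$ is the matching object, the limit being taken over the injective non-identity maps $[k]\to[n]$ in $\Delta$. **Theorem.** There does not exist a model structure on $\mathbf{DblCat}$ such that a double functor $K$ is a weak equivalence (respectively fibration) if and only if $N_hK$ is a weak equivalence (respectively fibration) in the Reedy model structure on $\mathbf{Cat}^{\Delta^{op}}$ associated to the categorical structure on $\mathbf{Cat}$. -/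

import Mathlib

open CategoryTheory CategoryTheory.Limits HomotopicalAlgebra Opposite Simplicial

universe v u

/-- A small (strict) double category, i.e. a category object in the category of small categories,
written out.  `hor` is the category of objects and horizontal morphisms, `ver` the category of
objects and vertical morphisms, and `Sq f j k g` is the set of squares with boundary
```
  a --f--> b
  |        |
  j        k
  v        v
  c --g--> d
```
The unit and associativity laws for squares relate squares whose boundaries are only
propositionally equal, hence the use of `HEq`. -/
structure DblCat : Type (u + 1) where
  Obj : Type u
  hor : Category.{u} Obj
  ver : Category.{u} Obj
  Sq {a b c d : Obj} (f : hor.Hom a b) (j : ver.Hom a c) (k : ver.Hom b d) (g : hor.Hom c d) :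
    Type u
  /-- horizontal identity square on a vertical morphism -/
  hid {a c : Obj} (j : ver.Hom a c) : Sq (hor.id a) j j (hor.id c)
  /-- horizontal composition of squares -/
  hcomp {a b c a' b' c' : Obj} {f : hor.Hom a b} {f' : hor.Hom b c}
    {j : ver.Hom a a'} {k : ver.Hom b b'} {l : ver.Hom c c'}
    {g : hor.Hom a' b'} {g' : hor.Hom b' c'} (α : Sq f j k g) (β : Sq f' k l g') :
    Sq (hor.comp f f') j l (hor.comp g g')
  /-- vertical identity square on a horizontal morphism -/
  vid {a b : Obj} (f : hor.Hom a b) : Sq f (ver.id a) (ver.id b) f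
  /-- vertical composition of squares -/
  vcomp {a b a' b' a'' b'' : Obj} {f : hor.Hom a b} {g : hor.Hom a' b'} {h : hor.Hom a'' b''}
    {j : ver.Hom a a'} {j' : ver.Hom a' a''} {k : ver.Hom b b'} {k' : ver.Hom b' b''}
    (α : Sq f j k g) (β : Sq g j' k' h) :
    Sq f (ver.comp j j') (ver.comp k k') h
  hid_hcomp {a b c d : Obj} {f : hor.Hom a b} {j : ver.Hom a c} {k : ver.Hom b d}
    {g : hor.Hom c d} (α : Sq f j k g) : HEq (hcomp (hid j) α) α
  hcomp_hid {a b c d : Obj} {f : hor.Hom a b} {j : ver.Hom a c} {k : ver.Hom b d}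
    {g : hor.Hom c d} (α : Sq f j k g) : HEq (hcomp α (hid k)) α
  hcomp_assoc {a b c d a' b' c' d' : Obj}
    {f : hor.Hom a b} {f' : hor.Hom b c} {f'' : hor.Hom c d}
    {j : ver.Hom a a'} {k : ver.Hom b b'} {l : ver.Hom c c'} {m : ver.Hom d d'}
    {g : hor.Hom a' b'} {g' : hor.Hom b' c'} {g'' : hor.Hom c' d'}
    (α : Sq f j k g) (β : Sq f' k l g') (γ : Sq f'' l m g'') :
    HEq (hcomp (hcomp α β) γ) (hcomp α (hcomp β γ))
  vid_vcomp {a b c d : Obj} {f : hor.Hom a b} {j : ver.Hom a c} {k : ver.Hom b d}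
    {g : hor.Hom c d} (α : Sq f j k g) : HEq (vcomp (vid f) α) α
  vcomp_vid {a b c d : Obj} {f : hor.Hom a b} {j : ver.Hom a c} {k : ver.Hom b d}
    {g : hor.Hom c d} (α : Sq f j k g) : HEq (vcomp α (vid g)) α
  vcomp_assoc {a b a' b' a'' b'' a''' b''' : Obj}
    {f : hor.Hom a b} {g : hor.Hom a' b'} {h : hor.Hom a'' b''} {i : hor.Hom a''' b'''}
    {j : ver.Hom a a'} {j' : ver.Hom a' a''} {j'' : ver.Hom a'' a'''}
    {k : ver.Hom b b'} {k' : ver.Hom b' b''} {k'' : ver.Hom b'' b'''}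
    (α : Sq f j k g) (β : Sq g j' k' h) (γ : Sq h j'' k'' i) :
    HEq (vcomp (vcomp α β) γ) (vcomp α (vcomp β γ))
  /-- the interchange law -/
  interchange {a b c a' b' c' a'' b'' c'' : Obj}
    {f : hor.Hom a b} {f' : hor.Hom b c} {g : hor.Hom a' b'} {g' : hor.Hom b' c'}
    {h : hor.Hom a'' b''} {h' : hor.Hom b'' c''}
    {j : ver.Hom a a'} {k : ver.Hom b b'} {l : ver.Hom c c'}
    {j' : ver.Hom a' a''} {k' : ver.Hom b' b''} {l' : ver.Hom c' c''}
    (α : Sq f j k g) (β : Sq f' k l g') (γ : Sq g j' k' h) (δ : Sq g' k' l' h') :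
    vcomp (hcomp α β) (hcomp γ δ) = hcomp (vcomp α γ) (vcomp β δ)
  hid_comp {a b c : Obj} (j : ver.Hom a b) (k : ver.Hom b c) :
    hid (ver.comp j k) = vcomp (hid j) (hid k)
  vid_comp {a b c : Obj} (f : hor.Hom a b) (g : hor.Hom b c) :
    vid (hor.comp f g) = hcomp (vid f) (vid g)
  hid_id (a : Obj) : hid (ver.id a) = vid (hor.id a)

namespace DblCat

/-- A double functor: functions on objects, horizontal morphisms, vertical morphisms and squares
which preserve all sources, targets, compositions and identities. -/
structure Hom (D E : DblCat.{u}) : Type u where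
  obj : D.Obj → E.Obj
  hmap {a b : D.Obj} (f : D.hor.Hom a b) : E.hor.Hom (obj a) (obj b)
  vmap {a b : D.Obj} (j : D.ver.Hom a b) : E.ver.Hom (obj a) (obj b)
  smap {a b c d : D.Obj} {f : D.hor.Hom a b} {j : D.ver.Hom a c} {k : D.ver.Hom b d}
    {g : D.hor.Hom c d} (α : D.Sq f j k g) : E.Sq (hmap f) (vmap j) (vmap k) (hmap g)
  hmap_id (a : D.Obj) : hmap (D.hor.id a) = E.hor.id (obj a)
  hmap_comp {a b c : D.Obj} (f : D.hor.Hom a b) (g : D.hor.Hom b c) :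
    hmap (D.hor.comp f g) = E.hor.comp (hmap f) (hmap g)
  vmap_id (a : D.Obj) : vmap (D.ver.id a) = E.ver.id (obj a)
  vmap_comp {a b c : D.Obj} (j : D.ver.Hom a b) (k : D.ver.Hom b c) :
    vmap (D.ver.comp j k) = E.ver.comp (vmap j) (vmap k)
  smap_hid {a c : D.Obj} (j : D.ver.Hom a c) : HEq (smap (D.hid j)) (E.hid (vmap j))
  smap_hcomp {a b c a' b' c' : D.Obj} {f : D.hor.Hom a b} {f' : D.hor.Hom b c}
    {j : D.ver.Hom a a'} {k : D.ver.Hom b b'} {l : D.ver.Hom c c'}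
    {g : D.hor.Hom a' b'} {g' : D.hor.Hom b' c'} (α : D.Sq f j k g) (β : D.Sq f' k l g') :
    HEq (smap (D.hcomp α β)) (E.hcomp (smap α) (smap β))
  smap_vid {a b : D.Obj} (f : D.hor.Hom a b) : HEq (smap (D.vid f)) (E.vid (hmap f))
  smap_vcomp {a b a' b' a'' b'' : D.Obj}
    {f : D.hor.Hom a b} {g : D.hor.Hom a' b'} {h : D.hor.Hom a'' b''}
    {j : D.ver.Hom a a'} {j' : D.ver.Hom a' a''} {k : D.ver.Hom b b'} {k' : D.ver.Hom b' b''}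
    (α : D.Sq f j k g) (β : D.Sq g j' k' h) :
    HEq (smap (D.vcomp α β)) (E.vcomp (smap α) (smap β))

theorem Hom.smap_heq {D E : DblCat.{u}} (K : Hom D E) {a b c d : D.Obj}
    {f f' : D.hor.Hom a b} {j j' : D.ver.Hom a c} {k k' : D.ver.Hom b d} {g g' : D.hor.Hom c d}
    (hf : f = f') (hj : j = j') (hk : k = k') (hg : g = g')
    {α : D.Sq f j k g} {α' : D.Sq f' j' k' g'} (h : HEq α α') : HEq (K.smap α) (K.smap α') := by
  subst hf hj hk hg
  cases h
  rfl

/-- The category of small double categories and double functors. -/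
instance : Category.{u} DblCat.{u} where
  Hom := Hom
  id D :=
    { obj := fun a => a
      hmap := fun f => f
      vmap := fun j => j
      smap := fun α => α
      hmap_id := fun _ => rfl
      hmap_comp := fun _ _ => rfl
      vmap_id := fun _ => rfl
      vmap_comp := fun _ _ => rfl
      smap_hid := fun _ => HEq.rfl
      smap_hcomp := fun _ _ => HEq.rfl
      smap_vid := fun _ => HEq.rfl
      smap_vcomp := fun _ _ => HEq.rfl }
  comp K L :=
    { obj := fun a => L.obj (K.obj a)
      hmap := fun f => L.hmap (K.hmap f)
      vmap := fun j => L.vmap (K.vmap j)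
      smap := fun α => L.smap (K.smap α)
      hmap_id := fun a => by rw [K.hmap_id, L.hmap_id]
      hmap_comp := fun f g => by rw [K.hmap_comp, L.hmap_comp]
      vmap_id := fun a => by rw [K.vmap_id, L.vmap_id]
      vmap_comp := fun j k => by rw [K.vmap_comp, L.vmap_comp]
      smap_hid := fun j =>
        (L.smap_heq (K.hmap_id _) rfl rfl (K.hmap_id _) (K.smap_hid j)).trans (L.smap_hid _)
      smap_hcomp := fun α β =>
        (L.smap_heq (K.hmap_comp _ _) rfl rfl (K.hmap_comp _ _) (K.smap_hcomp α β)).trans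
          (L.smap_hcomp _ _)
      smap_vid := fun f =>
        (L.smap_heq rfl (K.vmap_id _) (K.vmap_id _) rfl (K.smap_vid f)).trans (L.smap_vid _)
      smap_vcomp := fun α β =>
        (L.smap_heq rfl (K.vmap_comp _ _) (K.vmap_comp _ _) rfl (K.smap_vcomp α β)).trans
          (L.smap_vcomp _ _) }

/-- The objects of `D`, seen as the objects of the category `(Obj D, Hor D)`. -/
def H (D : DblCat.{u}) : Type u := D.Obj

instance (D : DblCat.{u}) : Category.{u} D.H := D.hor

/-- The functor `(Obj D, Hor D) ⥤ (Obj E, Hor E)` underlying a double functor. -/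
def Hom.hFunctor {D E : DblCat.{u}} (K : Hom D E) : D.H ⥤ E.H where
  obj := K.obj
  map f := K.hmap f
  map_id := K.hmap_id
  map_comp f g := K.hmap_comp f g

section Congruence

variable (D : DblCat.{u})

theorem hcomp_heq {a b c a' b' c' : D.Obj} {f f₁ : D.hor.Hom a b} {f' f₁' : D.hor.Hom b c}
    {j j₁ : D.ver.Hom a a'} {k k₁ : D.ver.Hom b b'} {l l₁ : D.ver.Hom c c'}
    {g g₁ : D.hor.Hom a' b'} {g' g₁' : D.hor.Hom b' c'}
    {α : D.Sq f j k g} {β : D.Sq f' k l g'} {α₁ : D.Sq f₁ j₁ k₁ g₁} {β₁ : D.Sq f₁' k₁ l₁ g₁'}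
    (hf : f = f₁) (hf' : f' = f₁') (hj : j = j₁) (hk : k = k₁) (hl : l = l₁)
    (hg : g = g₁) (hg' : g' = g₁') (hα : HEq α α₁) (hβ : HEq β β₁) :
    HEq (D.hcomp α β) (D.hcomp α₁ β₁) := by
  subst hf hf' hj hk hl hg hg'
  cases hα
  cases hβ
  rfl

theorem vcomp_heq {a b a' b' a'' b'' : D.Obj}
    {f f₁ : D.hor.Hom a b} {g g₁ : D.hor.Hom a' b'} {h h₁ : D.hor.Hom a'' b''}
    {j j₁ : D.ver.Hom a a'} {j' j₁' : D.ver.Hom a' a''}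
    {k k₁ : D.ver.Hom b b'} {k' k₁' : D.ver.Hom b' b''}
    {α : D.Sq f j k g} {β : D.Sq g j' k' h} {α₁ : D.Sq f₁ j₁ k₁ g₁} {β₁ : D.Sq g₁ j₁' k₁' h₁}
    (hf : f = f₁) (hg : g = g₁) (hh : h = h₁) (hj : j = j₁) (hj' : j' = j₁')
    (hk : k = k₁) (hk' : k' = k₁') (hα : HEq α α₁) (hβ : HEq β β₁) :
    HEq (D.vcomp α β) (D.vcomp α₁ β₁) := by
  subst hf hg hh hj hj' hk hk'
  cases hα
  cases hβ
  rfl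

theorem vid_heq {a b : D.Obj} {f f₁ : D.hor.Hom a b} (hf : f = f₁) :
    HEq (D.vid f) (D.vid f₁) := by
  subst hf
  rfl

end Congruence

/-- The objects of the `n`-th level of the horizontal nerve: functors from the ordinal
`[n] = {0 < ⋯ < n}` to `(Obj D, Hor D)`, i.e. paths of `n` composable horizontal morphisms. -/
structure Level (D : DblCat.{u}) (n : ℕ) : Type u where
  path : Fin (n + 1) ⥤ D.H

namespace Level

variable {D E : DblCat.{u}} {n : ℕ}

/-- The morphisms of the `n`-th level of the horizontal nerve: functors from `[n]` to
`(Ver D, Sq D)` (the category of vertical morphisms and squares under horizontal composition),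
with given top row and given bottom row. -/
structure Hom (F G : Level D n) : Type u where
  app (i : Fin (n + 1)) : D.ver.Hom (F.path.obj i) (G.path.obj i)
  sq {i j : Fin (n + 1)} (φ : i ⟶ j) :
    D.Sq (F.path.map φ) (app i) (app j) (G.path.map φ)
  sq_id (i : Fin (n + 1)) : HEq (sq (𝟙 i)) (D.hid (app i))
  sq_comp {i j k : Fin (n + 1)} (φ : i ⟶ j) (ψ : j ⟶ k) :
    HEq (sq (φ ≫ ψ)) (D.hcomp (sq φ) (sq ψ))

theorem Hom.ext_of_heq {F G : Level D n} {S T : Hom F G} (happ : S.app = T.app)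
    (hsq : ∀ {i j : Fin (n + 1)} (φ : i ⟶ j), HEq (S.sq φ) (T.sq φ)) : S = T := by
  obtain ⟨s, σ, _, _⟩ := S
  obtain ⟨t, τ, _, _⟩ := T
  obtain rfl : s = t := happ
  obtain rfl : @σ = @τ := by
    funext i j φ
    exact eq_of_heq (hsq φ)
  rfl

/-- The `n`-th level of the horizontal nerve is a category under vertical composition. -/
instance : Category.{u} (Level D n) where
  Hom := Hom
  id F :=
    { app := fun i => D.ver.id (F.path.obj i)
      sq := fun φ => D.vid (F.path.map φ)
      sq_id := fun i => (D.vid_heq (F.path.map_id i)).trans (heq_of_eq (D.hid_id _).symm)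
      sq_comp := fun φ ψ => (D.vid_heq (F.path.map_comp φ ψ)).trans (heq_of_eq (D.vid_comp _ _)) }
  comp {F G K} S T :=
    { app := fun i => D.ver.comp (S.app i) (T.app i)
      sq := fun φ => D.vcomp (S.sq φ) (T.sq φ)
      sq_id := fun i =>
        (D.vcomp_heq (F.path.map_id i) (G.path.map_id i) (K.path.map_id i) rfl rfl rfl rfl
          (S.sq_id i) (T.sq_id i)).trans (heq_of_eq (D.hid_comp _ _).symm)
      sq_comp := fun φ ψ =>
        (D.vcomp_heq (F.path.map_comp φ ψ) (G.path.map_comp φ ψ) (K.path.map_comp φ ψ)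
          rfl rfl rfl rfl (S.sq_comp φ ψ) (T.sq_comp φ ψ)).trans
            (heq_of_eq (D.interchange _ _ _ _)) }
  id_comp _ := Hom.ext_of_heq (funext fun _ => D.ver.id_comp _) fun _ => D.vid_vcomp _
  comp_id _ := Hom.ext_of_heq (funext fun _ => D.ver.comp_id _) fun _ => D.vcomp_vid _
  assoc _ _ _ := Hom.ext_of_heq (funext fun _ => D.ver.assoc _ _ _) fun _ => D.vcomp_assoc _ _ _

/-- Restriction along a functor `[m] ⥤ [n]` (the simplicial structure of the nerve). -/
def restrict (D : DblCat.{u}) {m n : ℕ} (Φ : Fin (m + 1) ⥤ Fin (n + 1)) :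
    Level D n ⥤ Level D m where
  obj F := ⟨Φ ⋙ F.path⟩
  map S :=
    { app := fun i => S.app (Φ.obj i)
      sq := fun φ => S.sq (Φ.map φ)
      sq_id := fun i => S.sq_id (Φ.obj i)
      sq_comp := fun φ ψ => S.sq_comp (Φ.map φ) (Φ.map ψ) }
  map_id _ := rfl
  map_comp _ _ := rfl

/-- Postcomposition with a double functor. -/
def postcomp (K : DblCat.Hom D E) (n : ℕ) : Level D n ⥤ Level E n where
  obj F := ⟨F.path ⋙ K.hFunctor⟩
  map {F G} S :=
    { app := fun i => K.vmap (S.app i)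
      sq := fun φ => K.smap (S.sq φ)
      sq_id := fun i =>
        (K.smap_heq (F.path.map_id i) rfl rfl (G.path.map_id i) (S.sq_id i)).trans
          (K.smap_hid _)
      sq_comp := fun φ ψ =>
        (K.smap_heq (F.path.map_comp φ ψ) rfl rfl (G.path.map_comp φ ψ) (S.sq_comp φ ψ)).trans
          (K.smap_hcomp _ _) }
  map_id _ := Hom.ext_of_heq (funext fun _ => K.vmap_id _) fun _ => K.smap_vid _
  map_comp _ _ := Hom.ext_of_heq (funext fun _ => K.vmap_comp _ _) fun _ => K.smap_vcomp _ _

end Level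

/-- The horizontal nerve of a double category, a simplicial object in `Cat`. -/
def horizontalNerve (D : DblCat.{u}) : SimplicialObject Cat.{u, u} where
  obj X := Cat.of (Level D X.unop.len)
  map f := (Level.restrict D (SimplexCategory.toCat.map f.unop).toFunctor).toCatHom
  map_id _ := rfl
  map_comp _ _ := rfl

/-- The horizontal nerve functor `N_h : DblCat ⥤ Cat^{Δᵒᵖ}`. -/
def Nh : DblCat.{u} ⥤ SimplicialObject Cat.{u, u} where
  obj D := D.horizontalNerve
  map K :=
    { app := fun X => (Level.postcomp K X.unop.len).toCatHom
      naturality := fun _ _ _ => rfl }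
  map_id _ := rfl
  map_comp _ _ := rfl

end DblCat

/-- The weak equivalences of the categorical model structure on `Cat`: equivalences of
categories. -/
def catWeakEquivalences : MorphismProperty Cat.{u, u} :=
  fun _ _ F => F.toFunctor.IsEquivalence

/-- The fibrations of the categorical model structure on `Cat`, the isofibrations: every
isomorphism `g : b ≅ F a` lifts to an isomorphism `f : a' ≅ a` with `F a' = b` and `F f = g`. -/
def catFibrations : MorphismProperty Cat.{u, u} :=
  fun A B F => ∀ (a : A) (b : B) (g : b ≅ F.toFunctor.obj a),
    ∃ (a' : A) (f : a' ≅ a) (h : F.toFunctor.obj a' = b),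
      F.toFunctor.map f.hom = eqToHom h ≫ g.hom

namespace Reedy

/-- The condition on an object `[k] ⟶ [n]` of `Δ / [n]` to be injective and not an isomorphism. -/
def properFace (n : ℕ) : ObjectProperty (Over ⦋n⦌) :=
  fun φ => Mono φ.hom ∧ ¬ IsIso φ.hom

/-- The opposite of the matching category of `[n] ∈ Δᵒᵖ`: its objects are the injective
non-identity maps `[k] ⟶ [n]`, its morphisms the maps over `[n]` (which are automatically
injective). -/
abbrev MatchingIndex (n : ℕ) : Type := (properFace n).FullSubcategory

variable {C : Type u} [Category.{v} C]

/-- The diagram on the matching category of `[n]` given by a simplicial object. -/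
abbrev matchingDiagram (X : SimplicialObject C) (n : ℕ) : (MatchingIndex n)ᵒᵖ ⥤ C :=
  ((properFace n).ι ⋙ Over.forget ⦋n⦌).op ⋙ X

variable [HasLimits C]

/-- The matching object `M_n X`. -/
noncomputable def matchingObject (X : SimplicialObject C) (n : ℕ) : C :=
  limit (matchingDiagram X n)

/-- The cone on the matching diagram with vertex `X_n` given by the structure maps of `X`. -/
def matchingCone (X : SimplicialObject C) (n : ℕ) : Cone (matchingDiagram X n) where
  pt := X _⦋n⦌
  π :=
    { app := fun φ => X.map φ.unop.obj.hom.op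
      naturality := fun φ ψ t => by
        refine (Category.id_comp _).trans ?_
        refine Eq.trans ?_ (X.map_comp _ _)
        exact congrArg (fun h => X.map h.op) (Over.w t.unop.hom).symm }

/-- The canonical map `X_n ⟶ M_n X`. -/
noncomputable def toMatchingObject (X : SimplicialObject C) (n : ℕ) :
    X _⦋n⦌ ⟶ matchingObject X n :=
  limit.lift (matchingDiagram X n) (matchingCone X n)

/-- Functoriality of the matching object. -/
noncomputable def matchingObjectMap {X Y : SimplicialObject C} (f : X ⟶ Y) (n : ℕ) :
    matchingObject X n ⟶ matchingObject Y n :=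
  limMap (Functor.whiskerLeft ((properFace n).ι ⋙ Over.forget ⦋n⦌).op f)

theorem toMatchingObject_naturality {X Y : SimplicialObject C} (f : X ⟶ Y) (n : ℕ) :
    f.app (op ⦋n⦌) ≫ toMatchingObject Y n = toMatchingObject X n ≫ matchingObjectMap f n := by
  apply limit.hom_ext
  intro φ
  erw [Category.assoc, Category.assoc, limit.lift_π, limMap_π, limit.lift_π_assoc]
  exact (f.naturality φ.unop.obj.hom.op).symm

/-- The relative matching map `X_n ⟶ Y_n ×_{M_n Y} M_n X` of `f : X ⟶ Y`. -/
noncomputable def relativeMatchingMap {X Y : SimplicialObject C} (f : X ⟶ Y) (n : ℕ) :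
    X _⦋n⦌ ⟶ pullback (toMatchingObject Y n) (matchingObjectMap f n) :=
  pullback.lift (f.app (op ⦋n⦌)) (toMatchingObject X n) (toMatchingObject_naturality f n)

/-- The Reedy weak equivalences of simplicial objects, for a class `W` of weak equivalences:
the levelwise weak equivalences. -/
def weakEquivalences (W : MorphismProperty C) : MorphismProperty (SimplicialObject C) :=
  fun _ _ f => ∀ n : ℕ, W (f.app (op ⦋n⦌))

/-- The Reedy fibrations of simplicial objects, for a class `P` of fibrations: the morphisms all
of whose relative matching maps are fibrations. -/
def fibrations (P : MorphismProperty C) : MorphismProperty (SimplicialObject C) :=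
  fun _ _ f => ∀ n : ℕ, P (relativeMatchingMap f n)

end Reedy

/-! The obstruction is one factorization. Let `brokenPath` have horizontal morphisms a → b and d →
c, a vertical isomorphism b ≅ d, and no horizontal morphism a → c. A model structure would factor
`brokenPath` → `point` as a trivial cofibration K followed by a fibration from some X.

Fibrancy at level 1 makes X_1 → X_0 × X_0 an isofibration, so horizontal morphisms of X can be
transported along vertical isomorphisms of their ends (`Reedy.exists_transport`). Transporting Ka →
Kb to Ka → Kd and composing with Kd → Kc gives a horizontal morphism Ka → Kc: the composite is
forced because X is a double category (`exists_hor_hom`).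

On the other hand K is a levelwise equivalence. Essential surjectivity at level 1 and fullness at
level 0 pull Ka → Kc back to a horizontal morphism of `brokenPath` whose ends are vertically related
to a and c. Only a and c themselves are, so this would be a morphism a → c (`isEmpty_hor_hom`). -/

namespace Reedy

/-! ### The matching object of [1] and transport of edges. -/

variable {C : Type u} [Category.{v} C]

/-- A proper face of `[1]` is constant. -/
theorem hom_eq_const_of_properFace_one (φ : MatchingIndex 1) :
    φ.obj.hom = SimplexCategory.const _ ⦋1⦌ (φ.obj.hom.toOrderHom 0) := by
  obtain ⟨φ, hmono, hiso⟩ := φ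
  have hlen : φ.left.len ≤ 1 := SimplexCategory.len_le_of_mono φ.hom
  have hne : φ.left.len ≠ 1 := fun h => hiso ((SimplexCategory.isIso_iff_of_mono φ.hom).2 h)
  have h0 : φ.left.len = 0 := by omega
  ext i : 3
  have hi : i = 0 := by
    apply Fin.ext
    have hi : (i : ℕ) < φ.left.len + 1 := i.2
    simp only [Fin.val_zero]
    omega
  subst hi
  rfl

/-- A pair of morphisms to `X_0` determines a cone over the matching diagram of `[1]`. -/
def matchingConeOfVertices (X : SimplicialObject C) {T : C} (V : Fin 2 → (T ⟶ X _⦋0⦌)) :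
    Cone (matchingDiagram X 1) where
  pt := T
  π :=
    { app := fun φ => V (φ.unop.obj.hom.toOrderHom 0) ≫
        X.map (SimplexCategory.const φ.unop.obj.left ⦋0⦌ 0).op
      naturality := fun φ ψ t => by
        -- Faces of [1] related by a map over [1] are constant at the same vertex.
        have h : ψ.unop.obj.hom.toOrderHom 0 = φ.unop.obj.hom.toOrderHom 0 := by
          have hw : t.unop.hom.left ≫ φ.unop.obj.hom = ψ.unop.obj.hom := Over.w t.unop.hom
          rw [← hw, hom_eq_const_of_properFace_one φ.unop]
          rfl
        refine (Category.id_comp _).trans ?_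
        rw [h]
        refine Eq.trans ?_ (Category.assoc _ _ _).symm
        congr 1
        refine Eq.trans ?_ (X.map_comp _ _)
        exact congrArg (fun h : ψ.unop.obj.left ⟶ ⦋0⦌ => X.map h.op) (Subsingleton.elim _ _) }

variable [HasLimits C]

/-- A pair of morphisms to `X_0` determines a morphism to `M_1 X`. -/
noncomputable def liftOfVertices (X : SimplicialObject C) {T : C} (V : Fin 2 → (T ⟶ X _⦋0⦌)) :
    T ⟶ matchingObject X 1 :=
  limit.lift (matchingDiagram X 1) (matchingConeOfVertices X V)

/-- Every proper face of [1] factors through a vertex, so maps into M_1 X can be compared on the two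
vertices. The extra map `p` allows a comparison at a single object of `T`. -/
theorem comp_toMatchingObject_eq (X : SimplicialObject C) {S T : C}
    (V : Fin 2 → (T ⟶ X _⦋0⦌)) (p : S ⟶ T) (q : S ⟶ X _⦋1⦌)
    (h : ∀ i : Fin 2, q ≫ X.map (SimplexCategory.const ⦋0⦌ ⦋1⦌ i).op = p ≫ V i) :
    q ≫ toMatchingObject X 1 = p ≫ liftOfVertices X V := by
  apply limit.hom_ext
  intro φ
  erw [Category.assoc, Category.assoc, limit.lift_π, limit.lift_π]
  change q ≫ X.map φ.unop.obj.hom.op = p ≫ V _ ≫ X.map _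
  rw [hom_eq_const_of_properFace_one φ.unop, SimplexCategory.const_fac_thru_zero, op_comp,
    X.map_comp, ← Category.assoc, ← Category.assoc, h]
  rfl

/-- The proper face of `[1]` given by a vertex. -/
def vertexIndex (i : Fin 2) : MatchingIndex 1 :=
  ⟨Over.mk (SimplexCategory.const ⦋0⦌ ⦋1⦌ i),
    SimplexCategory.mono_iff_injective.2 fun _ _ _ => Subsingleton.elim (α := Fin 1) _ _,
    fun h => absurd (@SimplexCategory.len_eq_of_isIso _ _ _ h) (by simp)⟩

/-- The projection of `M_1 X` to a copy of `X_0`. -/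
noncomputable def matchingVertex (X : SimplicialObject C) (i : Fin 2) :
    matchingObject X 1 ⟶ X _⦋0⦌ :=
  limit.π (matchingDiagram X 1) (op (vertexIndex i))

theorem toMatchingObject_matchingVertex (X : SimplicialObject C) (i : Fin 2) :
    toMatchingObject X 1 ≫ matchingVertex X i =
      X.map (SimplexCategory.const ⦋0⦌ ⦋1⦌ i).op :=
  limit.lift_π _ _

theorem liftOfVertices_matchingVertex (X : SimplicialObject C) {T : C}
    (V : Fin 2 → (T ⟶ X _⦋0⦌)) (i : Fin 2) :
    liftOfVertices X V ≫ matchingVertex X i = V i := by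
  refine (limit.lift_π _ _).trans ?_
  change V i ≫ X.map (SimplexCategory.const ⦋0⦌ ⦋0⦌ 0).op = V i
  rw [SimplexCategory.const_eq_id, op_id, X.map_id, Category.comp_id]

/-- Transport of a `1`-simplex of a Reedy fibrant simplicial category along isomorphisms of its
vertices: `V` is a pair of families of vertices indexed by a category `T`. -/
theorem exists_transport {X Y : SimplicialObject Cat.{u, u}} {f : X ⟶ Y}
    (hf : fibrations catFibrations f)
    (hY : ∀ (T : Cat.{u, u}) (n : ℕ), Nonempty (Unique (T ⟶ Y _⦋n⦌)))
    {T : Cat.{u, u}} (V : Fin 2 → (T ⟶ X _⦋0⦌)) {t t' : T} (e : t' ≅ t) (x : X _⦋1⦌)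
    (hx : ∀ i : Fin 2, (X.map (SimplexCategory.const ⦋0⦌ ⦋1⦌ i).op).toFunctor.obj x =
      (V i).toFunctor.obj t) :
    ∃ x' : X _⦋1⦌, ∀ i : Fin 2,
      (X.map (SimplexCategory.const ⦋0⦌ ⦋1⦌ i).op).toFunctor.obj x' = (V i).toFunctor.obj t' := by
  have hsub (S : Cat.{u, u}) (n : ℕ) (a b : S ⟶ Y _⦋n⦌) : a = b :=
    have := (hY S n).some
    Subsingleton.elim _ _
  -- M_1 Y is a limit of terminal objects. Hence the squares over `Y` commute automatically, and the
  -- pullback need not be identified with M_1 X.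
  have hM {S : Cat.{u, u}} (a b : S ⟶ matchingObject Y 1) : a = b :=
    limit.hom_ext fun φ => hsub S φ.unop.obj.left.len _ _
  let y : T ⟶ Y _⦋1⦌ := (hY T 1).some.default
  -- Indexing the vertices by `T` pays off here: the functor `l` carries `e` to an isomorphism in
  -- the pullback, which never has to be described by hand.
  let l : T ⟶ pullback (toMatchingObject Y 1) (matchingObjectMap f 1) :=
    pullback.lift y (liftOfVertices X V) (hM _ _)
  -- Objects are treated as functors from the point, so that equality of objects of the pullback
  -- follows from its universal property.
  let pt : Cat.{u, u} := Cat.of (Discrete PUnit.{u + 1})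
  let p : pt ⟶ T := (Functor.fromPUnit t).toCatHom
  let q : pt ⟶ X _⦋1⦌ := (Functor.fromPUnit x).toCatHom
  have hpq : p ≫ l = q ≫ relativeMatchingMap f 1 := by
    apply pullback.hom_ext
    · exact hsub _ _ _ _
    · rw [Category.assoc, Category.assoc]
      erw [pullback.lift_snd, pullback.lift_snd]
      refine (comp_toMatchingObject_eq X V p q fun i => ?_).symm
      apply Cat.Hom.ext
      refine CategoryTheory.Functor.ext (fun _ => hx i) ?_
      rintro ⟨⟨⟩⟩ ⟨⟨⟩⟩ ⟨⟨⟨⟩⟩⟩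
      erw [CategoryTheory.Functor.map_id, CategoryTheory.Functor.map_id]
      simp
  have hobj : l.toFunctor.obj t = (relativeMatchingMap f 1).toFunctor.obj x :=
    congrArg (fun F : pt ⟶ _ => F.toFunctor.obj ⟨⟨⟩⟩) hpq
  obtain ⟨x', -, hx', -⟩ := hf 1 x (l.toFunctor.obj t') (l.toFunctor.mapIso e ≪≫ eqToIso hobj)
  refine ⟨x', fun i => ?_⟩
  have h1 : relativeMatchingMap f 1 ≫ pullback.snd _ _ ≫ matchingVertex X i =
      X.map (SimplexCategory.const ⦋0⦌ ⦋1⦌ i).op := by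
    rw [← toMatchingObject_matchingVertex, ← Category.assoc]
    congr 1
    exact pullback.lift_snd _ _ _
  have h2 : l ≫ pullback.snd _ _ ≫ matchingVertex X i = V i := by
    rw [← liftOfVertices_matchingVertex X V i, ← Category.assoc]
    congr 1
    exact pullback.lift_snd _ _ _
  rw [← h1, ← h2]
  exact congrArg (pullback.snd _ _ ≫ matchingVertex X i).toFunctor.obj hx'

end Reedy

/-! ### Double categories given by two preorders, and the terminal one. -/

namespace DblCat

/-- The category with a morphism `a ⟶ b` exactly when `r a b`. -/
@[reducible]
def relCategory {α : Type u} (r : α → α → Prop) (hr : ∀ a, r a a)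
    (hr' : ∀ a b c, r a b → r b c → r a c) : Category.{u} α where
  Hom a b := ULift.{u} (PLift (r a b))
  id a := ⟨⟨hr a⟩⟩
  comp f g := ⟨⟨hr' _ _ _ f.down.down g.down.down⟩⟩

/-- The double category with horizontal morphisms given by a reflexive transitive relation `r`,
vertical morphisms given by a reflexive transitive relation `s`, and exactly one square in each
boundary. -/
def ofRel {α : Type u} (r s : α → α → Prop) (hr : ∀ a, r a a)
    (hr' : ∀ a b c, r a b → r b c → r a c) (hs : ∀ a, s a a)
    (hs' : ∀ a b c, s a b → s b c → s a c) : DblCat.{u} where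
  Obj := α
  hor := relCategory r hr hr'
  ver := relCategory s hs hs'
  Sq _ _ _ _ := PUnit
  hid _ := ⟨⟩
  hcomp _ _ := ⟨⟩
  vid _ := ⟨⟩
  vcomp _ _ := ⟨⟩
  hid_hcomp _ := HEq.rfl
  hcomp_hid _ := HEq.rfl
  hcomp_assoc _ _ _ := HEq.rfl
  vid_vcomp _ := HEq.rfl
  vcomp_vid _ := HEq.rfl
  vcomp_assoc _ _ _ := HEq.rfl
  interchange _ _ _ _ := rfl
  hid_comp _ _ := rfl
  vid_comp _ _ := rfl
  hid_id _ := rfl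

section OfRel

variable {α : Type u} {r s : α → α → Prop} {hr : ∀ a, r a a}
  {hr' : ∀ a b c, r a b → r b c → r a c} {hs : ∀ a, s a a}
  {hs' : ∀ a b c, s a b → s b c → s a c} {n : ℕ}

theorem level_ofRel_ext {F G : Level (ofRel r s hr hr' hs hs') n}
    (h : ∀ i, F.path.obj i = G.path.obj i) : F = G := by
  obtain ⟨F⟩ := F
  obtain ⟨G⟩ := G
  congr 1
  exact CategoryTheory.Functor.ext h fun _ _ _ => rfl

/-- A chain for `r` as an object of the nerve. -/
def levelOfChain (p : Fin (n + 1) → α) (hp : ∀ i j, i ≤ j → r (p i) (p j)) :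
    Level (ofRel r s hr hr' hs hs') n :=
  ⟨{ obj := p
     map := fun φ => ⟨⟨hp _ _ (leOfHom φ)⟩⟩
     map_id := fun _ => rfl
     map_comp := fun _ _ => rfl }⟩

/-- Pointwise `s`-related objects of the nerve are connected by a morphism. -/
def levelHomOfRel {F G : Level (ofRel r s hr hr' hs hs') n}
    (h : ∀ i, s (F.path.obj i) (G.path.obj i)) : F ⟶ G where
  app i := ⟨⟨h i⟩⟩
  sq _ := ⟨⟩
  sq_id _ := HEq.rfl
  sq_comp _ _ := HEq.rfl

theorem levelHom_ofRel_subsingleton (F G : Level (ofRel r s hr hr' hs hs') n) :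
    Subsingleton (F ⟶ G) :=
  ⟨fun _ _ => Level.Hom.ext_of_heq
    (funext fun _ => Subsingleton.elim (α := ULift (PLift (s _ _))) _ _) fun _ => HEq.rfl⟩

end OfRel

/-- The double category with one object and only identity morphisms and squares. -/
def point : DblCat.{u} :=
  ofRel (α := PUnit.{u + 1}) (fun _ _ => True) (fun _ _ => True)
    (fun _ => trivial) (fun _ _ _ _ _ => trivial) (fun _ => trivial) (fun _ _ _ _ _ => trivial)

/-- The unique double functor to `point`. -/
def toPoint (D : DblCat.{u}) : D ⟶ point where
  obj _ := ⟨⟩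
  hmap _ := ⟨⟨trivial⟩⟩
  vmap _ := ⟨⟨trivial⟩⟩
  smap _ := ⟨⟩
  hmap_id _ := rfl
  hmap_comp _ _ := rfl
  vmap_id _ := rfl
  vmap_comp _ _ := rfl
  smap_hid _ := HEq.rfl
  smap_hcomp _ _ := HEq.rfl
  smap_vid _ := HEq.rfl
  smap_vcomp _ _ := HEq.rfl

/-- Supplies the hypothesis on the base in `Reedy.exists_transport`: each level of the nerve of
`point` has one object and at most one morphism between any two objects. -/
theorem unique_hom_nerve_point (T : Cat.{u, u}) (n : ℕ) :
    Nonempty (Unique (T ⟶ (Nh.obj point.{u}) _⦋n⦌)) := by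
  let F₀ : Level point.{u} n := levelOfChain (fun _ => ⟨⟩) fun _ _ _ => trivial
  refine ⟨⟨⟨((Functor.const T).obj F₀).toCatHom⟩, fun G => ?_⟩⟩
  apply Cat.Hom.ext
  refine CategoryTheory.Functor.ext (fun _ => level_ofRel_ext fun _ => rfl) fun _ _ _ => ?_
  exact (levelHom_ofRel_subsingleton _ _).elim _ _

/-- Objects of `(N_h D)_0` are determined by their value. -/
theorem level_zero_ext {D : DblCat.{u}} {F G : Level D 0} (h : F.path.obj 0 = G.path.obj 0) :
    F = G := by
  obtain ⟨F⟩ := F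
  obtain ⟨G⟩ := G
  congr 1
  exact ComposableArrows.ext₀ h

/-! ### The counterexample. -/

/-- The objects of the double category `brokenPath`. -/
inductive BrokenPathObj : Type u where
  | a
  | b
  | d
  | c

namespace BrokenPathObj

/-- The horizontal order: `a ≤ b` and `d ≤ c`. -/
def horRel (x y : BrokenPathObj.{u}) : Prop := x = y ∨ (x = a ∧ y = b) ∨ (x = d ∧ y = c)

/-- The vertical order: `b` and `d` are isomorphic. -/
def verRel (x y : BrokenPathObj.{u}) : Prop := x = y ∨ (x = b ∧ y = d) ∨ (x = d ∧ y = b)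

end BrokenPathObj

open BrokenPathObj

/-- The double category generated by horizontal morphisms `a ⟶ b`, `d ⟶ c` and a vertical
isomorphism between `b` and `d`. -/
def brokenPath : DblCat.{u} :=
  ofRel horRel verRel (fun _ => Or.inl rfl)
    (by rintro (_ | _) (_ | _) (_ | _) <;> simp [horRel]) (fun _ => Or.inl rfl)
    (by rintro (_ | _) (_ | _) (_ | _) <;> simp [verRel])

/-- An object of `brokenPath` as a vertex of the nerve. -/
def vertex (x : BrokenPathObj.{u}) : Level brokenPath.{u} 0 :=
  levelOfChain (fun _ => x) fun _ _ _ => Or.inl rfl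

/-- The horizontal morphism `a ⟶ b` as an edge of the nerve. -/
def edge : Level brokenPath.{u} 1 :=
  levelOfChain ![a, b] (by
    intro i j h
    fin_cases i <;> fin_cases j <;> simp_all [horRel])

/-- The vertical isomorphism between `d` and `b`. -/
def vertexIso : vertex.{u} d ≅ vertex b where
  hom := levelHomOfRel fun _ => Or.inr (Or.inr ⟨rfl, rfl⟩)
  inv := levelHomOfRel fun _ => Or.inr (Or.inl ⟨rfl, rfl⟩)
  hom_inv_id := (levelHom_ofRel_subsingleton _ _).elim _ _
  inv_hom_id := (levelHom_ofRel_subsingleton _ _).elim _ _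

/-! ### Fibrancy against levelwise equivalence. -/

/-- In a double category with a fibrant horizontal nerve, the two horizontal morphisms of
`brokenPath` become composable. -/
theorem exists_hor_hom {X : DblCat.{u}} (K : brokenPath ⟶ X) {L : X ⟶ point}
    (hL : Reedy.fibrations catFibrations.{u} (Nh.map L)) :
    Nonempty (X.hor.Hom (K.obj a) (K.obj c)) := by
  -- The source stays fixed at `a` while the target varies, so `vertexIso` moves the endpoints (a,
  -- b) of `edge` to (a, d).
  let W : Fin 2 → (Cat.of (Level brokenPath.{u} 0) ⟶ (Nh.obj brokenPath.{u}) _⦋0⦌) :=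
    ![((Functor.const _).obj (vertex a)).toCatHom, 𝟙 _]
  obtain ⟨x', hx'⟩ := Reedy.exists_transport hL unique_hom_nerve_point
    (fun i => W i ≫ (Nh.map K).app (op ⦋0⦌)) vertexIso.{u}
    (((Nh.map K).app (op ⦋1⦌)).toFunctor.obj edge) (fun i => by
      refine level_zero_ext ?_
      fin_cases i <;> rfl)
  have h0 : x'.path.obj 0 = K.obj a :=
    congrArg (fun F : Level X 0 => F.path.obj 0) (hx' 0)
  have h1 : x'.path.obj 1 = K.obj d :=
    congrArg (fun F : Level X 0 => F.path.obj 0) (hx' 1)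
  have f : x'.path.obj 0 ⟶ x'.path.obj 1 := x'.path.map (homOfLE (by decide))
  rw [h0, h1] at f
  exact ⟨X.hor.comp f (K.hmap (a := d) (b := c) ⟨⟨Or.inr (Or.inr ⟨rfl, rfl⟩)⟩⟩)⟩

/-- A double functor out of `brokenPath` inducing equivalences on nerves does not make its two
horizontal morphisms composable. -/
theorem isEmpty_hor_hom {X : DblCat.{u}} (K : brokenPath ⟶ X)
    (hK : Reedy.weakEquivalences catWeakEquivalences.{u} (Nh.map K)) :
    IsEmpty (X.hor.Hom (K.obj a) (K.obj c)) := by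
  refine ⟨fun h => ?_⟩
  have h0 : (Level.postcomp K 0).IsEquivalence := hK 0
  have h1 : (Level.postcomp K 1).IsEquivalence := hK 1
  let P : Level X 1 := ⟨ComposableArrows.mk₁ (C := X.H) h⟩
  let F := (Level.postcomp K 1).objPreimage P
  let e : (Level.postcomp K 1).obj F ≅ P := (Level.postcomp K 1).objObjPreimageIso P
  -- Restricting `e` to the vertex `i` gives an isomorphism between images under K; fullness at
  -- level 0 lifts it to a vertical morphism of `brokenPath`.
  have key (i : Fin 2) (x : BrokenPathObj.{u}) (hx : P.path.obj i = K.obj x) :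
      verRel (F.path.obj i) x := by
    let R (D : DblCat.{u}) : Level D 1 ⥤ Level D 0 := Level.restrict D ((Functor.const _).obj i)
    have hR : (R X).obj P = (Level.postcomp K 0).obj (vertex x) := level_zero_ext hx
    let e' : (Level.postcomp K 0).obj ((R _).obj F) ≅ (Level.postcomp K 0).obj (vertex x) :=
      (R X).mapIso e ≪≫ eqToIso hR
    exact (((Level.postcomp K 0).preimage e'.hom).app 0).down.down
  have ha : verRel (F.path.obj 0) a := key 0 a rfl
  have hc : verRel (F.path.obj 1) c := key 1 c rfl
  have hF : horRel (F.path.obj 0) (F.path.obj 1) :=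
    (F.path.map (homOfLE (by decide : (0 : Fin 2) ≤ 1))).down.down
  -- Only `b` and `d` have a nontrivial vertical relation, so `F` runs from `a` to `c`.
  simp only [verRel, reduceCtorEq, and_false, or_false] at ha hc
  rw [ha, hc] at hF
  simp [horRel] at hF

end DblCat

theorem mainTheorem3 :
    ¬ ∃ _ : ModelCategory DblCat.{u},
      ∀ {D E : DblCat.{u}} (K : D ⟶ E),
        (WeakEquivalence K ↔
          Reedy.weakEquivalences catWeakEquivalences.{u} (DblCat.Nh.map K)) ∧
        (Fibration K ↔
          Reedy.fibrations catFibrations.{u} (DblCat.Nh.map K)) := by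
  rintro ⟨_, h⟩
  -- Of the model structure, only this factorization and the descriptions of its two classes are
  -- used.
  let fac := MorphismProperty.factorizationData (trivialCofibrations DblCat.{u})
    (fibrations DblCat.{u}) (DblCat.toPoint DblCat.brokenPath)
  have hi := (h fac.i).1.1 ((weakEquivalence_iff _).2 fac.hi.2)
  have hp := (h fac.p).2.1 ((fibration_iff _).2 fac.hp)
  exact (DblCat.exists_hor_hom fac.i hp).elim (DblCat.isEmpty_hor_hom fac.i hi).false
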